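/- Let $2\le k<n$ be integers, and read indices in $[n]=\{1,\dots,n\}$ modulo $n$. Write $e_J=\sum_{j\in J}e_j$. **Weight.** For $k$-subsets $I,J$ of $[n]$ let $d(e_J,e_I)$ be the minimal number of steps of the form $e_i-e_{i+1}$ needed to travel from $e_J$ to $e_I$ along edges of the hypersimplex $\Delta(k,n)=\mathrm{conv}(e_K: K\in\binom{[n]}{k})$, and put $\mathfrak h_J=\frac1n\sum_I d(e_J,e_I)\,e^I\in\mathbb R^{\binom{[n]}{k}}$. There is exactly one linear functional $\mathrm{wt}_{\rm PK}:\mathbb R^{\binom{[n]}{k}}\to\mathbb R$, the *PK weight*, with $\mathrm{wt}_{\rm PK}(\mathfrak h_J)=0$ if $J$ is a cyclic interval and $\mathrm{wt}_{\rm PK}(\mathfrak h_J)=1$ otherwise. **Positive tropical Plücker vectors.** A vector $\pi_\bullet\in\mathbb R^{\binom{[n]}{k}}$ is a positive tropical Plücker vector if $\pi_{Sac}+\pi_{Sbd}=\min(\pi_{Sab}+\pi_{Scd},\,\pi_{Sad}+\pi_{Sbc})$ for all $S\in\binom{[n]}{k-2}$ and $a<b<c<d$ in $[n]\setminus S$.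 The lineality space $L_{k,n}$ is the span of the vectors $\sum_{I\ni i}e^I$, $i\in[n]$. A *balanced central representative* of $\pi_\bullet$ is a vector $\hat\pi_\bullet\in\pi_\bullet+L_{k,n}$ with $$\hat\pi_{\{j+1,\dots,j+k\}}-\hat\pi_{\{j+1,\dots,j+k-1,\,j+k+1\}}=\tfrac1n\,\mathrm{wt}_{\rm PK}(\pi_\bullet)\qquad\text{for all } j=0,\dots,n-1.$$ **Bounded complex.** The tropical linear space $L(\pi_\bullet)$ is the set of $x\in\mathbb R^n/\mathbb R(1,\dots,1)$ such that for every $\tau\in\binom{[n]}{k+1}$ the minimum $\min_{i\in\tau}(\pi_{\tau\setminus\{i\}}+x_i)$ is achieved at least twice. For $x\in\mathbb R^n$ let $M(\pi^x_\bullet)$ be the set of those $k$-subsets at which $\pi^x_I:=\pi_I-\sum_{i\in I}x_i$ is minimal. The faces of $L(\pi_\bullet)$ are the sets $\{y: M(\pi^x_\bullet)\subseteq M(\pi^y_\bullet)\}$ with $x\in L(\pi_\bullet)$, and the bounded complex $B(\pi_\bullet)$ is the union of the bounded faces. **Theorem.** Let $\pi_\bullet$ be any positive tropical Plücker vector. Then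 $\mathrm{wt}_{\rm PK}(\pi_\bullet)\ge0$, a balanced central representative of $\pi_\bullet$ exists, and every balanced central representative $\hat\pi_\bullet$ of $\pi_\bullet$ satisfies $$B(\hat\pi_\bullet)\subseteq \mathrm{wt}_{\rm PK}(\pi_\bullet)\cdot\Delta_{\rm std},\qquad \Delta_{\rm std}=\{x\in\mathbb R^n/\mathbb R(1,\dots,1): x_u-x_v\le1\text{ for all }u,v\in[n]\},$$ where $\Delta_{\rm std}$ is the fundamental alcoved simplex. In particular, the PK weight bounds the diameter of the bounded complex: for every $\rho_\bullet\in\pi_\bullet+L_{k,n}$ and all $x,y\in B(\rho_\bullet)$, $$\max_{u,v\in[n]}\bigl((x-y)_u-(x-y)_v\bigr)\le\mathrm{wt}_{\rm PK}(\pi_\bullet).$$ -/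

import Mathlib

open scoped Pointwise

namespace PosTrop

/-- The `k`-element subsets of `{1, …, n}`; the element `i` is represented by `i - 1 : Fin n`. -/
abbrev KSubset (n k : ℕ) : Type := {I : Finset (Fin n) // I.card = k}

/-- The coordinate of a vector indexed by `k`-subsets at a finset of cardinality `k`
(the value `0` at other finsets is never used). -/
noncomputable def coord {n k : ℕ} (π : KSubset n k → ℝ) (I : Finset (Fin n)) : ℝ :=
  if h : I.card = k then π ⟨I, h⟩ else 0

/-- Positive tropical Plücker vectors: the three-term positive tropical Plücker relations. -/
def IsPositiveTropicalPlucker {n k : ℕ} (π : KSubset n k → ℝ) : Prop :=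
  ∀ S : Finset (Fin n), S.card + 2 = k →
    ∀ a b c d : Fin n, a < b → b < c → c < d → a ∉ S → b ∉ S → c ∉ S → d ∉ S →
      coord π (S ∪ {a, c}) + coord π (S ∪ {b, d}) =
        min (coord π (S ∪ {a, b}) + coord π (S ∪ {c, d}))
          (coord π (S ∪ {a, d}) + coord π (S ∪ {b, c}))

/-- `i + t`, read cyclically modulo `n`. -/
def cycAdd {n : ℕ} (i : Fin n) (t : ℕ) : Fin n :=
  ⟨(i.val + t) % n, Nat.mod_lt _ i.pos⟩

/-- The cyclic interval of length `k` whose first element is `j`. -/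
def cyc {n : ℕ} (k : ℕ) (j : Fin n) : Finset (Fin n) :=
  (Finset.range k).image (cycAdd j)

/-- The gap-cyclic interval: `cyc k j` with its last element replaced by its cyclic successor. -/
def gap {n : ℕ} (k : ℕ) (j : Fin n) : Finset (Fin n) :=
  insert (cycAdd j k) ((Finset.range (k - 1)).image (cycAdd j))

/-- One directed step `e_B = e_A + (e_i - e_{i+1})` between vertices of the hypersimplex. -/
def IsStep {n k : ℕ} (A B : KSubset n k) : Prop :=
  ∃ i : Fin n, i ∉ A.1 ∧ cycAdd i 1 ∈ A.1 ∧ B.1 = insert i (A.1.erase (cycAdd i 1))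

/-- The directed distance `d(e_A, e_B)`: the least number of steps `e_i - e_{i+1}` that lead
from `e_A` to `e_B` through vertices of the hypersimplex. -/
noncomputable def directedDist {n k : ℕ} (A B : KSubset n k) : ℕ :=
  sInf {m : ℕ | ∃ p : ℕ → KSubset n k, p 0 = A ∧ p m = B ∧ ∀ t < m, IsStep (p t) (p (t + 1))}

/-- The planar basis element `h_J`. -/
noncomputable def planarElement {n k : ℕ} (J : KSubset n k) : KSubset n k → ℝ :=
  fun I => (1 / (n : ℝ)) * (directedDist J I : ℝ)

/-- The condition that defines the planar kinematics weight: the linear functional takes the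
value `0` on `h_J` for `J` a cyclic interval, and `1` on `h_J` for the other `k`-subsets. -/
def IsPKWeight {n k : ℕ} (wt : (KSubset n k → ℝ) →ₗ[ℝ] ℝ) : Prop :=
  ∀ J : KSubset n k,
    ((∃ j : Fin n, J.1 = cyc k j) → wt (planarElement J) = 0) ∧
    ((¬ ∃ j : Fin n, J.1 = cyc k j) → wt (planarElement J) = 1)

/-- The planar kinematics (PK) weight: the linear functional satisfying `IsPKWeight`. -/
noncomputable def pkWeight (n k : ℕ) : (KSubset n k → ℝ) →ₗ[ℝ] ℝ :=
  Classical.epsilon IsPKWeight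

/-- The lineality space, spanned by the vectors `∑_{I ∋ i} e^I`. -/
def lineality (n k : ℕ) : Submodule ℝ (KSubset n k → ℝ) :=
  Submodule.span ℝ (Set.range fun i : Fin n => fun I : KSubset n k => if i ∈ I.1 then (1 : ℝ) else 0)

/-- `ρ` is a balanced central representative of `π`: it is equal to `π` modulo lineality, and
all its cyclic-gap differences are equal to `wt_PK(π) / n`. -/
def IsBalancedRep {n k : ℕ} (π ρ : KSubset n k → ℝ) : Prop :=
  ρ - π ∈ lineality n k ∧
    ∀ j : Fin n, coord ρ (cyc k j) - coord ρ (gap k j) = (1 / (n : ℝ)) * pkWeight n k π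

/-- The quotient `ℝⁿ / ℝ(1, …, 1)`. -/
abbrev Torus (n : ℕ) : Type := (Fin n → ℝ) ⧸ Submodule.span ℝ {(1 : Fin n → ℝ)}

/-- The class in `ℝⁿ / ℝ(1, …, 1)` of a vector. -/
def toTorus {n : ℕ} : (Fin n → ℝ) →ₗ[ℝ] Torus n :=
  (Submodule.span ℝ {(1 : Fin n → ℝ)}).mkQ

/-- The function `x ↦ x_u - x_v` on `ℝⁿ / ℝ(1, …, 1)`. -/
def coordDiff {n : ℕ} (u v : Fin n) : Torus n →ₗ[ℝ] ℝ :=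
  (Submodule.span ℝ {(1 : Fin n → ℝ)}).liftQ
    (LinearMap.proj (R := ℝ) (φ := fun _ : Fin n => ℝ) u - LinearMap.proj v)
    (by rw [Submodule.span_singleton_le_iff_mem]; simp)

/-- The tropical distance `max_{u,v} ((x - y)_u - (x - y)_v)` on `ℝⁿ / ℝ(1, …, 1)`. -/
noncomputable def tropDist {n : ℕ} (x y : Torus n) : ℝ :=
  ⨆ p : Fin n × Fin n, coordDiff p.1 p.2 (x - y)

/-- The tropical linear space of `π`. -/
def tropLinearSpace {n k : ℕ} (π : KSubset n k → ℝ) : Set (Torus n) :=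
  toTorus '' {w | ∀ τ : Finset (Fin n), τ.card = k + 1 →
    ∃ i ∈ τ, ∃ j ∈ τ, i ≠ j ∧
      coord π (τ.erase i) + w i = coord π (τ.erase j) + w j ∧
      ∀ l ∈ τ, coord π (τ.erase i) + w i ≤ coord π (τ.erase l) + w l}

/-- The shift `π^w`, with `π^w_I = π_I - ∑_{i ∈ I} w_i`. -/
def shift {n k : ℕ} (π : KSubset n k → ℝ) (w : Fin n → ℝ) : KSubset n k → ℝ :=
  fun I => π I - ∑ i ∈ I.1, w i

/-- The bases of the matroid `M(ν)`: the `k`-subsets at which `ν` is minimal. -/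
def initialBases {n k : ℕ} (ν : KSubset n k → ℝ) : Set (KSubset n k) :=
  {I | ∀ J, ν I ≤ ν J}

/-- The closed cell dual to the matroid polytope with set of bases `M`: the points `y` such that
every element of `M` is a basis of `M(π^y)`.  For `M = M(π^x)` with `x` in the tropical linear
space this is the face that has `x` in its relative interior. -/
def dualCell {n k : ℕ} (π : KSubset n k → ℝ) (M : Set (KSubset n k)) : Set (Torus n) :=
  toTorus '' {y | M ⊆ initialBases (shift π y)}

/-- The faces of the matroid complex structure of the tropical linear space. -/
def IsFace {n k : ℕ} (π : KSubset n k → ℝ) (F : Set (Torus n)) : Prop :=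
  ∃ w : Fin n → ℝ, toTorus w ∈ tropLinearSpace π ∧ F = dualCell π (initialBases (shift π w))

/-- A subset of `ℝⁿ / ℝ(1, …, 1)` is bounded if its tropical diameter is finite. -/
def IsBddSet {n : ℕ} (F : Set (Torus n)) : Prop :=
  ∃ C : ℝ, ∀ x ∈ F, ∀ y ∈ F, tropDist x y ≤ C

/-- The bounded complex `B(π)`: the union of the bounded faces of the tropical linear space. -/
def boundedComplex {n k : ℕ} (π : KSubset n k → ℝ) : Set (Torus n) :=
  {x | ∃ F, IsFace π F ∧ IsBddSet F ∧ x ∈ F}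

/-- The fundamental alcoved simplex `{x : x_u - x_v ≤ 1 for all u, v}`. -/
def alcovedSimplex (n : ℕ) : Set (Torus n) :=
  {x | ∀ u v : Fin n, coordDiff u v x ≤ 1}

end PosTrop

/-!
For a `k`-subset `J` of the circle, write `cyc k j` for the cyclic interval that starts at `j`,
`a = j + k - 1` for its last element, and `gap k j` for the set in which `a` is replaced by
`a + 1`. The proof rests on two facts.

**The PK weight is `∑ j, (π (cyc k j) - π (gap k j))`** (`pkWeight_eq_gapForm`). A step into a
cyclic interval can only come from the gap-cyclic interval, so `d(J, cyc k j) = d(J, gap k j) + 1`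
unless `J = cyc k j`, when the distances are `0` and `n - 1`; summing over `j` gives the prescribed
values on the planar elements. For uniqueness, distances are computed as totals of flows on the
circle (`IsNormalFlow.directedDist_eq`): the flow whose minimum is zero can be carried out step by
step. If `w` is orthogonal to all distances, then the alternating sum of the relations at the sets
reached from `J` by simultaneous single steps isolates `w J` (`card_mul_eq_of_orthogonal`) and
shows `w = 0`.

**Cyclic intervals are extremal** (`IsPositiveTropicalPlucker.sub_le_gap`). For every `T` that
contains neither `a` nor `a + 1`, the three-term relations give
`π (T ∪ {a}) - π (T ∪ {a + 1}) ≤ π (cyc k j) - π (gap k j)`.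
Applied to the steps of a closed walk that uses each `e_i - e_{i+1}` once, this yields that the PK
weight is nonnegative. It also yields `x_a - x_{a+1} ≤ π (cyc k j) - π (gap k j)` for each point
`x` of the bounded complex (`IsPositiveTropicalPlucker.coordDiff_le`): otherwise each basis of
`M(π^x)` that contains `a + 1` contains `a`, whereas the matroid of the bounded face, whose bases
are among those of `M(π^x)`, has no coloop and no loop and so has a basis that contains `a + 1` but
not `a`.

The bounds on consecutive differences add up to the PK weight. If they are all equal, summing them
along an arc bounds every `x_u - x_v` by the PK weight; for two points `x`, `y`, summing along an
arc for `x` and along its complement for `y` bounds their distance.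
-/

namespace PosTrop

variable {n k : ℕ}

/-! ### Cyclic arithmetic on `Fin n` -/


lemma cycAdd_zero (i : Fin n) : cycAdd i 0 = i :=
  Fin.ext (by simp [cycAdd, Nat.mod_eq_of_lt i.isLt])

lemma cycAdd_cycAdd (i : Fin n) (s t : ℕ) : cycAdd (cycAdd i s) t = cycAdd i (s + t) :=
  Fin.ext (by simp [cycAdd, add_assoc])

lemma cycAdd_inj {i : Fin n} {s t : ℕ} (hs : s < n) (ht : t < n)
    (h : cycAdd i s = cycAdd i t) : s = t := by
  have h' : i.val + s ≡ i.val + t [MOD n] := by simpa [cycAdd, Nat.ModEq] using h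
  have h2 := Nat.ModEq.add_left_cancel' _ h'
  rwa [Nat.ModEq, Nat.mod_eq_of_lt hs, Nat.mod_eq_of_lt ht] at h2

lemma exists_cycAdd_eq (i j : Fin n) : ∃ t < n, cycAdd i t = j := by
  refine ⟨(j.val + (n - i.val)) % n, Nat.mod_lt _ i.pos, Fin.ext ?_⟩
  have hi := i.isLt
  simp only [cycAdd, Nat.add_mod_mod]
  rw [show i.val + (j.val + (n - i.val)) = j.val + n by omega]
  simp [Nat.mod_eq_of_lt j.isLt]

lemma cycAdd_bijective (t : ℕ) : Function.Bijective fun i : Fin n => cycAdd i t := by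
  rw [← Finite.injective_iff_bijective]
  intro i j h
  have h' : i.val + t ≡ j.val + t [MOD n] := by simpa [cycAdd, Nat.ModEq] using h
  have h2 := Nat.ModEq.add_right_cancel' _ h'
  rw [Nat.ModEq, Nat.mod_eq_of_lt i.isLt, Nat.mod_eq_of_lt j.isLt] at h2
  exact Fin.ext h2

lemma cycAdd_one_ne (hn : 2 ≤ n) (i : Fin n) : cycAdd i 1 ≠ i := by
  intro h
  have := cycAdd_inj (i := i) (s := 1) (t := 0) (by omega) (by omega) (by rw [h, cycAdd_zero])
  omega

lemma sum_cycAdd (t : ℕ) (f : Fin n → ℝ) : ∑ i, f (cycAdd i t) = ∑ i, f i :=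
  (cycAdd_bijective t).sum_comp f

/-- A property of points of the circle that passes from `i` to `i + 1` holds everywhere as soon as
it holds somewhere. -/
lemma cyclic_induction {P : Fin n → Prop} {z : Fin n} (hz : P z)
    (hs : ∀ i, P i → P (cycAdd i 1)) (i : Fin n) : P i := by
  obtain ⟨t, -, rfl⟩ := exists_cycAdd_eq z i
  induction t with
  | zero => rwa [cycAdd_zero]
  | succ t ih => rw [← cycAdd_cycAdd]; exact hs _ ih

/-- A coordinate difference is the sum of the consecutive differences along the arc from `u`
to `v`. -/
lemma exists_arc (u v : Fin n) : ∃ A : Finset (Fin n),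
    ∀ z : Fin n → ℝ, z u - z v = ∑ i ∈ A, (z i - z (cycAdd i 1)) := by
  obtain ⟨t, ht, rfl⟩ := exists_cycAdd_eq u v
  refine ⟨(Finset.range t).image (cycAdd u), fun z => ?_⟩
  rw [Finset.sum_image]
  · simp_rw [cycAdd_cycAdd]
    rw [Finset.sum_range_sub', cycAdd_zero]
  · intro a ha b hb h
    simp only [Finset.coe_range, Set.mem_Iio] at ha hb
    exact cycAdd_inj (by omega) (by omega) h

lemma mem_cyc {j : Fin n} {i : Fin n} : i ∈ cyc k j ↔ ∃ t < k, cycAdd j t = i := by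
  simp [cyc]

/-- The elements that `cyc k j` and `gap k j` have in common. -/
def stem (k : ℕ) (j : Fin n) : Finset (Fin n) := (Finset.range (k - 1)).image (cycAdd j)

lemma mem_stem {j : Fin n} {i : Fin n} : i ∈ stem k j ↔ ∃ t < k - 1, cycAdd j t = i := by
  simp [stem]

lemma cyc_eq_insert (hk : 1 ≤ k) (j : Fin n) :
    cyc k j = insert (cycAdd j (k - 1)) (stem k j) := by
  obtain ⟨k, rfl⟩ := Nat.exists_eq_add_of_le' hk
  simp [cyc, stem, Finset.range_add_one, Finset.image_insert]

lemma gap_eq_insert (j : Fin n) : gap k j = insert (cycAdd j k) (stem k j) := rfl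

lemma card_image_cycAdd {t : ℕ} (ht : t ≤ n) (j : Fin n) :
    ((Finset.range t).image (cycAdd j)).card = t := by
  rw [Finset.card_image_of_injOn, Finset.card_range]
  intro a ha b hb h
  simp only [Finset.coe_range, Set.mem_Iio] at ha hb
  exact cycAdd_inj (by omega) (by omega) h

lemma card_cyc (hkn : k < n) (j : Fin n) : (cyc k j).card = k :=
  card_image_cycAdd hkn.le j

lemma card_stem (hkn : k < n) (j : Fin n) : (stem k j).card = k - 1 :=
  card_image_cycAdd (by omega) j

lemma last_notMem_stem (hk : 1 ≤ k) (hkn : k < n) (j : Fin n) :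
    cycAdd j (k - 1) ∉ stem k j := by
  rw [mem_stem]
  rintro ⟨t, ht, h⟩
  have := cycAdd_inj (by omega) (by omega) h
  omega

lemma next_notMem_stem (hkn : k < n) (j : Fin n) : cycAdd j k ∉ stem k j := by
  rw [mem_stem]
  rintro ⟨t, ht, h⟩
  have := cycAdd_inj (by omega) (by omega) h
  omega

lemma last_ne_next (hk : 1 ≤ k) (hkn : k < n) (j : Fin n) :
    cycAdd j (k - 1) ≠ cycAdd j k := by
  intro h
  have := cycAdd_inj (by omega) (by omega) h
  omega

lemma card_gap (hk : 1 ≤ k) (hkn : k < n) (j : Fin n) : (gap k j).card = k := by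
  rw [gap_eq_insert, Finset.card_insert_of_notMem (next_notMem_stem hkn j), card_stem hkn]
  omega

/-- The cyclic interval as a `k`-subset. -/
def cycSet (hkn : k < n) (j : Fin n) : KSubset n k := ⟨cyc k j, card_cyc hkn j⟩

/-- The gap-cyclic interval as a `k`-subset. -/
def gapSet (hk : 1 ≤ k) (hkn : k < n) (j : Fin n) : KSubset n k := ⟨gap k j, card_gap hk hkn j⟩

/-- The last element is the only place where a cyclic interval ends. -/
lemma eq_last_of_mem_cyc {i j : Fin n} (hi : i ∈ cyc k j) (hi' : cycAdd i 1 ∉ cyc k j) :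
    i = cycAdd j (k - 1) := by
  obtain ⟨t, ht, rfl⟩ := mem_cyc.1 hi
  rw [cycAdd_cycAdd, mem_cyc] at hi'
  have : ¬ t + 1 < k := fun h => hi' ⟨t + 1, h, rfl⟩
  rw [show t = k - 1 by omega]

/-- A cyclic interval starts at only one place. -/
lemma cycAdd_one_eq_of_mem_cyc {i j : Fin n} (hi : i ∉ cyc k j) (hi' : cycAdd i 1 ∈ cyc k j) :
    cycAdd i 1 = j := by
  obtain ⟨t, ht, h⟩ := mem_cyc.1 hi'
  rcases t with - | t
  · rw [← h, cycAdd_zero]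
  · rw [← cycAdd_cycAdd] at h
    exact absurd (mem_cyc.2 ⟨t, by omega, (cycAdd_bijective 1).1 h⟩) hi

lemma next_notMem_cyc (hkn : k < n) (j : Fin n) : cycAdd j k ∉ cyc k j := by
  rw [mem_cyc]
  rintro ⟨t, ht, h⟩
  have := cycAdd_inj (by omega) (by omega) h
  omega

lemma cyc_injective (hk : 1 ≤ k) (hkn : k < n) : Function.Injective (cyc (n := n) k) := by
  intro i j h
  have h1 : cycAdd i (k - 1) ∈ cyc k j := h ▸ mem_cyc.2 ⟨k - 1, by omega, rfl⟩
  have h2 : cycAdd (cycAdd i (k - 1)) 1 ∉ cyc k j := by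
    rw [← h, cycAdd_cycAdd, Nat.sub_add_cancel hk]
    exact next_notMem_cyc hkn i
  exact (cycAdd_bijective (k - 1)).1 (eq_last_of_mem_cyc h1 h2)

/-! ### Flows on the circle and the directed distance -/

/-- The integer-valued indicator function of a finset. -/
def ind (A : Finset (Fin n)) (i : Fin n) : ℤ := if i ∈ A then 1 else 0

/-- `m` is a flow from `A` to `B`: if `m i` counts the steps `e_i - e_{i+1}`, then these steps
together transport `e_A` to `e_B`. -/
def IsFlow (A B : Finset (Fin n)) (m : Fin n → ℤ) : Prop :=
  ∀ i, ind B (cycAdd i 1) - ind A (cycAdd i 1) = m (cycAdd i 1) - m i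

/-- A flow with minimum zero; it is the only one between the given sets. -/
structure IsNormalFlow (A B : Finset (Fin n)) (m : Fin n → ℤ) : Prop where
  isFlow : IsFlow A B m
  nonneg : ∀ i, 0 ≤ m i
  exists_zero : ∃ z, m z = 0

/-- `B` arises from `A` by one step `e_i - e_{i+1}` for each `i ∈ M`. -/
def IsShift (A B M : Finset (Fin n)) : Prop :=
  ∀ i, ind B (cycAdd i 1) = ind A (cycAdd i 1) + ind M (cycAdd i 1) - ind M i

lemma ind_nonneg (A : Finset (Fin n)) (i : Fin n) : 0 ≤ ind A i := by
  unfold ind; split_ifs <;> simp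

lemma ind_le_one (A : Finset (Fin n)) (i : Fin n) : ind A i ≤ 1 := by
  unfold ind; split_ifs <;> simp

lemma ind_of_mem {A : Finset (Fin n)} {i : Fin n} (h : i ∈ A) : ind A i = 1 := if_pos h

lemma ind_of_notMem {A : Finset (Fin n)} {i : Fin n} (h : i ∉ A) : ind A i = 0 := if_neg h

lemma sum_ind (A : Finset (Fin n)) : ∑ i, ind A i = A.card := by
  simp [ind]

lemma ind_injective : Function.Injective (ind (n := n)) := by
  intro A B h
  ext i
  have := congrFun h i
  by_cases hA : i ∈ A <;> by_cases hB : i ∈ B <;> simp_all [ind]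

lemma ext_of_ind_succ {A B : Finset (Fin n)} (h : ∀ i, ind A (cycAdd i 1) = ind B (cycAdd i 1)) :
    A = B := by
  apply ind_injective
  funext x
  obtain ⟨i, rfl⟩ := (cycAdd_bijective 1).2 x
  exact h i

lemma IsFlow.sub_shift {A B C M : Finset (Fin n)} {m : Fin n → ℤ} (h : IsFlow A C m)
    (hs : IsShift A B M) : IsFlow B C (fun i => m i - ind M i) := by
  intro i
  have := h i
  have := hs i
  linarith

lemma IsFlow.add_shift {A B C M : Finset (Fin n)} {m : Fin n → ℤ} (h : IsFlow C A m)
    (hs : IsShift A B M) : IsFlow C B (fun i => m i + ind M i) := by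
  intro i
  have := h i
  have := hs i
  linarith

lemma isFlow_zero (A : Finset (Fin n)) : IsFlow A A 0 := fun i => by simp

lemma IsFlow.sub_eq_const {A B : Finset (Fin n)} {m m' : Fin n → ℤ} (h : IsFlow A B m)
    (h' : IsFlow A B m') (i z : Fin n) : m i - m' i = m z - m' z := by
  refine cyclic_induction (P := fun i => m i - m' i = m z - m' z) rfl (fun j hj => ?_) i
  have := h j
  have := h' j
  linarith

/-- Partial sums of the difference of the indicator functions give a flow. -/
lemma exists_isFlow (A B : Finset (Fin n)) (h : A.card = B.card) : ∃ m, IsFlow A B m := by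
  refine ⟨fun i => ∑ j ∈ Finset.Iic i, (ind B j - ind A j), fun i => ?_⟩
  have hi := i.isLt
  by_cases hl : i.val + 1 < n
  · have hv : (cycAdd i 1).val = i.val + 1 := Nat.mod_eq_of_lt hl
    have : Finset.Iic (cycAdd i 1) = insert (cycAdd i 1) (Finset.Iic i) := by
      ext x
      simp only [Finset.mem_Iic, Finset.mem_insert, Fin.le_def, Fin.ext_iff, hv]
      omega
    simp only [this]
    rw [Finset.sum_insert (by simp [Fin.le_def, hv])]
    ring
  -- When `i + 1` wraps around to `0`, the total of the differences matters; it is zero.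
  · have hv : (cycAdd i 1).val = 0 := by
      simp [cycAdd, show i.val + 1 = n by omega]
    have h1 : Finset.Iic (cycAdd i 1) = {cycAdd i 1} := by
      ext x
      simp only [Finset.mem_Iic, Finset.mem_singleton, Fin.le_def, Fin.ext_iff, hv]
      omega
    have h2 : Finset.Iic i = Finset.univ := by
      ext x
      simp only [Finset.mem_Iic, Finset.mem_univ, Fin.le_def, iff_true]
      omega
    simp only [h1, h2, Finset.sum_singleton, Finset.sum_sub_distrib, sum_ind, h]
    ring

lemma exists_isNormalFlow [Nonempty (Fin n)] (A B : Finset (Fin n)) (h : A.card = B.card) :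
    ∃ m, IsNormalFlow A B m := by
  obtain ⟨m, hm⟩ := exists_isFlow A B h
  obtain ⟨z, hz⟩ := Finite.exists_min m
  exact ⟨fun i => m i - m z, fun i => by rw [hm i]; ring, fun i => by linarith [hz i], z, by simp⟩

/-- Steps can be chosen greedily: as long as a normal flow does not vanish, one of the steps it
prescribes is possible. Otherwise the support of the flow would avoid `A` and be closed under
passing to the cyclic successor. -/
lemma IsNormalFlow.exists_step {A B : Finset (Fin n)} {m : Fin n → ℤ} (h : IsNormalFlow A B m)
    {y : Fin n} (hy : 0 < m y) : ∃ i, i ∉ A ∧ cycAdd i 1 ∈ A ∧ 0 < m i := by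
  by_contra! hno
  obtain ⟨z, hz⟩ := h.exists_zero
  have key : ∀ i, 0 < m i → i ∉ A := by
    refine cyclic_induction (z := z) (by simp [hz]) (fun i ih hi hA => ?_)
    have h1 := h.isFlow i
    have h2 := ind_le_one B (cycAdd i 1)
    rw [ind_of_mem hA] at h1
    have h3 : 0 < m i := by linarith
    linarith [hno i (ih h3) hA]
  have pos : ∀ i, 0 < m i := by
    refine cyclic_induction hy (fun i hi => ?_)
    have hA : cycAdd i 1 ∉ A := fun hA => by linarith [hno i (key i hi) hA]
    have h1 := h.isFlow i
    have h2 := ind_nonneg B (cycAdd i 1)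
    rw [ind_of_notMem hA] at h1
    linarith
  exact (pos z).ne' hz

lemma isShift_step (hn : 2 ≤ n) {A : Finset (Fin n)} {i : Fin n} (hi : i ∉ A)
    (hi' : cycAdd i 1 ∈ A) : IsShift A (insert i (A.erase (cycAdd i 1))) {i} := by
  intro y
  have hne := cycAdd_one_ne hn i
  have hinj : cycAdd y 1 = cycAdd i 1 ↔ y = i := (cycAdd_bijective 1).1.eq_iff
  simp only [ind, Finset.mem_insert, Finset.mem_erase, Finset.mem_singleton, ne_eq, hinj]
  by_cases h1 : y = i
  · subst h1
    simp [hne, hi']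
  · by_cases h2 : cycAdd y 1 = i
    · simp [h2, h1, hi]
    · simp [h1, h2]

lemma IsStep.exists_isShift (hn : 2 ≤ n) {A B : KSubset n k} (h : IsStep A B) :
    ∃ i, IsShift A.1 B.1 {i} := by
  obtain ⟨i, hi, hi', hB⟩ := h
  exact ⟨i, hB ▸ isShift_step hn hi hi'⟩

lemma card_step {A : Finset (Fin n)} {i : Fin n} (hi : i ∉ A) (hi' : cycAdd i 1 ∈ A) :
    (insert i (A.erase (cycAdd i 1))).card = A.card := by
  rw [Finset.card_insert_of_notMem (by simp [hi]), Finset.card_erase_of_mem hi']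
  exact Nat.sub_add_cancel (Finset.card_pos.2 ⟨_, hi'⟩)

lemma exists_isStep (A : KSubset n k) {i : Fin n} (hi : i ∉ A.1) (hi' : cycAdd i 1 ∈ A.1) :
    ∃ B : KSubset n k, IsStep A B ∧ B.1 = insert i (A.1.erase (cycAdd i 1)) :=
  ⟨⟨_, (card_step hi hi').trans A.2⟩, ⟨i, hi, hi', rfl⟩, rfl⟩

/-- The numbers of steps in which one can travel from `A` to `B`. -/
def pathLengths (A B : KSubset n k) : Set ℕ :=
  {m : ℕ | ∃ p : ℕ → KSubset n k, p 0 = A ∧ p m = B ∧ ∀ t < m, IsStep (p t) (p (t + 1))}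

lemma directedDist_eq_sInf (A B : KSubset n k) : directedDist A B = sInf (pathLengths A B) := rfl

lemma zero_mem_pathLengths (A : KSubset n k) : 0 ∈ pathLengths A A :=
  ⟨fun _ => A, rfl, rfl, fun _ h => absurd h (Nat.not_lt_zero _)⟩

lemma succ_mem_pathLengths {A B C : KSubset n k} {L : ℕ} (h : IsStep A B)
    (hL : L ∈ pathLengths B C) : L + 1 ∈ pathLengths A C := by
  obtain ⟨p, h0, hL', hp⟩ := hL
  refine ⟨fun t => if t = 0 then A else p (t - 1), rfl, by simpa using hL', fun t ht => ?_⟩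
  rcases t with - | t
  · simpa [h0] using h
  · simpa using hp t (by omega)

/-- A path determines a nonnegative flow whose total is its length. -/
lemma exists_flow_of_mem_pathLengths (hn : 2 ≤ n) {A B : KSubset n k} {L : ℕ}
    (hL : L ∈ pathLengths A B) :
    ∃ m, IsFlow A.1 B.1 m ∧ (∀ i, 0 ≤ m i) ∧ ∑ i, m i = L := by
  obtain ⟨p, h0, hL', hp⟩ := hL
  suffices ∀ t ≤ L, ∃ m, IsFlow A.1 (p t).1 m ∧ (∀ i, 0 ≤ m i) ∧ ∑ i, m i = t by
    simpa [hL'] using this L le_rfl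
  intro t
  induction t with
  | zero => exact fun _ => ⟨0, h0 ▸ isFlow_zero _, fun _ => le_rfl, by simp⟩
  | succ t ih =>
    intro ht
    obtain ⟨m, hm, hpos, hsum⟩ := ih (by omega)
    obtain ⟨i, hi⟩ := (hp t (by omega)).exists_isShift hn
    refine ⟨_, hm.add_shift hi, fun j => add_nonneg (hpos j) (ind_nonneg _ _), ?_⟩
    rw [Finset.sum_add_distrib, hsum, sum_ind]
    simp

lemma IsNormalFlow.eq_of_sum_eq_zero {A B : KSubset n k} {m : Fin n → ℤ}
    (h : IsNormalFlow A.1 B.1 m) (hs : ∑ i, m i = 0) : A = B ∧ ∀ i, m i = 0 := by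
  have h0 : ∀ i, m i = 0 := fun i =>
    (Finset.sum_eq_zero_iff_of_nonneg (fun i _ => h.nonneg i)).1 hs i (Finset.mem_univ i)
  refine ⟨Subtype.ext (ext_of_ind_succ fun i => ?_), h0⟩
  have := h.isFlow i
  rw [h0, h0] at this
  linarith

/-- A normal flow that does not vanish starts with a possible step, and what remains is a normal
flow again. -/
lemma IsNormalFlow.exists_step_sub (hn : 2 ≤ n) {A B : KSubset n k} {m : Fin n → ℤ} {L : ℕ}
    (h : IsNormalFlow A.1 B.1 m) (hs : ∑ i, m i = (L + 1 : ℕ)) :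
    ∃ (i : Fin n) (C : KSubset n k), i ∉ A.1 ∧ cycAdd i 1 ∈ A.1 ∧
      C.1 = insert i (A.1.erase (cycAdd i 1)) ∧
      IsNormalFlow C.1 B.1 (fun j => m j - ind {i} j) ∧ ∑ j, (m j - ind {i} j) = L := by
  obtain ⟨y, -, hy⟩ : ∃ y ∈ Finset.univ, 0 < m y := by
    apply Finset.exists_lt_of_sum_lt
    rw [hs]
    simp only [Finset.sum_const_zero]
    positivity
  obtain ⟨i, hi, hi', hpos⟩ := h.exists_step hy
  refine ⟨i, ⟨_, (card_step hi hi').trans A.2⟩, hi, hi', rfl,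
    ⟨h.isFlow.sub_shift (isShift_step hn hi hi'), fun j => ?_, ?_⟩, ?_⟩
  · by_cases hj : j = i
    · subst hj
      rw [ind_of_mem (by simp)]
      linarith
    · rw [ind_of_notMem (by simpa using hj)]
      simpa using h.nonneg j
  · obtain ⟨z, hz⟩ := h.exists_zero
    refine ⟨z, ?_⟩
    rw [ind_of_notMem, hz, sub_zero]
    rw [Finset.mem_singleton]
    rintro rfl
    exact hpos.ne' hz
  · rw [Finset.sum_sub_distrib, hs, sum_ind]
    simp

lemma IsNormalFlow.mem_pathLengths (hn : 2 ≤ n) {B : KSubset n k} (L : ℕ) :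
    ∀ {A : KSubset n k} {m : Fin n → ℤ}, IsNormalFlow A.1 B.1 m → ∑ i, m i = L →
      L ∈ pathLengths A B := by
  induction L with
  | zero => exact fun {A m} h hs => (h.eq_of_sum_eq_zero hs).1 ▸ zero_mem_pathLengths A
  | succ L ih =>
    intro A m h hs
    obtain ⟨i, C, hi, hi', hC, hm, hs'⟩ := h.exists_step_sub hn hs
    exact succ_mem_pathLengths ⟨i, hi, hi', hC⟩ (ih hm hs')

/-- The directed distance is the total of the normal flow. -/
lemma IsNormalFlow.directedDist_eq (hn : 2 ≤ n) {A B : KSubset n k} {m : Fin n → ℤ}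
    (h : IsNormalFlow A.1 B.1 m) : (directedDist A B : ℤ) = ∑ i, m i := by
  obtain ⟨L, hL⟩ := Int.eq_ofNat_of_zero_le (Finset.sum_nonneg fun i _ => h.nonneg i)
  have hmem : L ∈ pathLengths A B := h.mem_pathLengths hn L hL
  rw [hL, directedDist_eq_sInf]
  norm_cast
  refine le_antisymm (Nat.sInf_le hmem) (le_csInf ⟨L, hmem⟩ fun L' hL' => ?_)
  obtain ⟨m', hm', hpos, hs⟩ := exists_flow_of_mem_pathLengths hn hL'
  obtain ⟨z, hz⟩ := h.exists_zero
  have : ∑ i, m i ≤ ∑ i, m' i := Finset.sum_le_sum fun i _ => by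
    have h1 := h.isFlow.sub_eq_const hm' i z
    have h2 := hpos z
    rw [hz] at h1
    linarith
  rw [hL, hs] at this
  exact_mod_cast this

/-- If the minimum `μ` of a flow is not zero, it has to be subtracted. -/
lemma IsFlow.directedDist_eq (hn : 2 ≤ n) {A B : KSubset n k} {m : Fin n → ℤ}
    (h : IsFlow A.1 B.1 m) {μ : ℤ} (hμ : ∀ i, μ ≤ m i) {z : Fin n} (hz : m z = μ) :
    (directedDist A B : ℤ) = ∑ i, m i - n * μ := by
  have : IsNormalFlow A.1 B.1 (fun i => m i - μ) :=
    ⟨fun i => by rw [h i]; ring, fun i => by linarith [hμ i], z, by simp [hz]⟩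
  rw [this.directedDist_eq hn]
  simp

lemma directedDist_self (A : KSubset n k) : directedDist A A = 0 :=
  Nat.eq_zero_of_le_zero (Nat.sInf_le (zero_mem_pathLengths A))

lemma pathLengths_nonempty (hn : 2 ≤ n) (A B : KSubset n k) : (pathLengths A B).Nonempty := by
  have : Nonempty (Fin n) := ⟨⟨0, by omega⟩⟩
  obtain ⟨m, hm⟩ := exists_isNormalFlow A.1 B.1 (A.2.trans B.2.symm)
  obtain ⟨L, hL⟩ := Int.eq_ofNat_of_zero_le (Finset.sum_nonneg fun i _ => hm.nonneg i)
  exact ⟨L, hm.mem_pathLengths hn L hL⟩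

lemma directedDist_pos (hn : 2 ≤ n) {A B : KSubset n k} (h : A ≠ B) : 0 < directedDist A B := by
  obtain ⟨p, h0, hL, -⟩ := Nat.sInf_mem (pathLengths_nonempty hn A B)
  rw [Nat.pos_iff_ne_zero]
  intro hd
  rw [← directedDist_eq_sInf, hd] at hL
  exact h (h0.symm.trans hL)

/-! ### An explicit formula for the PK weight -/

/-- The linear functional `π ↦ ∑ j, (π (cyc k j) - π (gap k j))`. -/
noncomputable def gapForm (hk : 1 ≤ k) (hkn : k < n) : (KSubset n k → ℝ) →ₗ[ℝ] ℝ :=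
  ∑ j : Fin n, (LinearMap.proj (R := ℝ) (φ := fun _ : KSubset n k => ℝ) (cycSet hkn j) -
    LinearMap.proj (gapSet hk hkn j))

lemma gapForm_apply (hk : 1 ≤ k) (hkn : k < n) (π : KSubset n k → ℝ) :
    gapForm hk hkn π = ∑ j : Fin n, (π (cycSet hkn j) - π (gapSet hk hkn j)) := by
  simp [gapForm, LinearMap.sum_apply]

lemma snoc_mem_pathLengths {A B C : KSubset n k} {L : ℕ} (hL : L ∈ pathLengths A B)
    (h : IsStep B C) : L + 1 ∈ pathLengths A C := by
  obtain ⟨p, h0, hL', hp⟩ := hL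
  refine ⟨fun t => if t ≤ L then p t else C, by simpa using h0, by simp, fun t ht => ?_⟩
  rcases Nat.lt_succ_iff_lt_or_eq.1 ht with ht | rfl
  · simpa [ht.le, Nat.succ_le_of_lt ht] using hp t ht
  · simpa [hL'] using h

lemma succ_last (hk : 1 ≤ k) (j : Fin n) : cycAdd (cycAdd j (k - 1)) 1 = cycAdd j k := by
  rw [cycAdd_cycAdd, Nat.sub_add_cancel hk]

lemma last_notMem_gap (hk : 1 ≤ k) (hkn : k < n) (j : Fin n) : cycAdd j (k - 1) ∉ gap k j := by
  rw [gap_eq_insert, Finset.mem_insert, not_or]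
  exact ⟨last_ne_next hk hkn j, last_notMem_stem hk hkn j⟩

lemma next_mem_gap (hk : 1 ≤ k) (j : Fin n) : cycAdd (cycAdd j (k - 1)) 1 ∈ gap k j := by
  rw [succ_last hk]
  exact Finset.mem_insert_self _ _

lemma cyc_eq_step (hk : 1 ≤ k) (hkn : k < n) (j : Fin n) :
    cyc k j = insert (cycAdd j (k - 1)) ((gap k j).erase (cycAdd (cycAdd j (k - 1)) 1)) := by
  rw [succ_last hk, cyc_eq_insert hk, gap_eq_insert,
    Finset.erase_insert (next_notMem_stem hkn j)]

lemma isStep_gapSet_cycSet (hk : 1 ≤ k) (hkn : k < n) (j : Fin n) :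
    IsStep (gapSet hk hkn j) (cycSet hkn j) :=
  ⟨cycAdd j (k - 1), last_notMem_gap hk hkn j, next_mem_gap hk j, cyc_eq_step hk hkn j⟩

lemma isFlow_cyc_gap (hk : 1 ≤ k) (hkn : k < n) (j : Fin n) :
    IsFlow (cyc k j) (gap k j) (fun x => - ind {cycAdd j (k - 1)} x) := fun x => by
  have := isShift_step (by omega) (last_notMem_gap hk hkn j) (next_mem_gap hk j) x
  rw [← cyc_eq_step hk hkn] at this
  linarith

/-- The only vertex with a step to a cyclic interval is the gap-cyclic interval. -/
lemma IsStep.eq_gapSet (hk : 1 ≤ k) (hkn : k < n) {P : KSubset n k} {j : Fin n}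
    (h : IsStep P (cycSet hkn j)) : P = gapSet hk hkn j := by
  obtain ⟨i, hi, hi', hP⟩ := h
  change cyc k j = _ at hP
  have hne := cycAdd_one_ne (by omega) i
  have hlast : i = cycAdd j (k - 1) := by
    apply eq_last_of_mem_cyc
    · rw [hP]; simp
    · rw [hP]; simp [hne]
  apply Subtype.ext
  change P.1 = gap k j
  have h1 : (cyc k j).erase i = P.1.erase (cycAdd i 1) := by
    rw [hP, Finset.erase_insert (by simp [hi])]
  rw [cyc_eq_insert hk, hlast, Finset.erase_insert (last_notMem_stem hk hkn j), succ_last hk] at h1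
  rw [hlast, succ_last hk] at hi'
  rw [gap_eq_insert, h1, Finset.insert_erase hi']

lemma directedDist_cycSet (hk : 1 ≤ k) (hkn : k < n) {J : KSubset n k} {j : Fin n}
    (h : J ≠ cycSet hkn j) :
    directedDist J (cycSet hkn j) = directedDist J (gapSet hk hkn j) + 1 := by
  have hn : 2 ≤ n := by omega
  apply le_antisymm
  · exact Nat.sInf_le (snoc_mem_pathLengths (Nat.sInf_mem (pathLengths_nonempty hn _ _))
      (isStep_gapSet_cycSet hk hkn j))
  · have hpos := directedDist_pos hn h
    obtain ⟨p, h0, hL, hp⟩ := Nat.sInf_mem (pathLengths_nonempty hn J (cycSet hkn j))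
    rw [← directedDist_eq_sInf] at hL hp
    obtain ⟨L, hLd⟩ := Nat.exists_eq_add_of_le' hpos
    rw [hLd] at hL hp ⊢
    have hstep := hp L (by omega)
    rw [hL] at hstep
    have : L ∈ pathLengths J (gapSet hk hkn j) :=
      ⟨p, h0, hstep.eq_gapSet hk hkn, fun t ht => hp t (by omega)⟩
    exact Nat.add_le_add_right (Nat.sInf_le this) 1

lemma directedDist_cycSet_gapSet (hk : 1 ≤ k) (hkn : k < n) (j : Fin n) :
    (directedDist (cycSet hkn j) (gapSet hk hkn j) : ℤ) = n - 1 := by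
  have hn : 2 ≤ n := by omega
  have hf : IsFlow (cycSet hkn j).1 (gapSet hk hkn j).1 _ := isFlow_cyc_gap hk hkn j
  rw [hf.directedDist_eq hn (μ := -1) (z := cycAdd j (k - 1))
    (fun x => by linarith [ind_le_one {cycAdd j (k - 1)} x])
    (by rw [ind_of_mem (by simp)]), Finset.sum_neg_distrib, sum_ind]
  simp
  ring

lemma isPKWeight_gapForm (hk : 1 ≤ k) (hkn : k < n) : IsPKWeight (gapForm hk hkn) := by
  have hn : (n : ℝ) ≠ 0 := by
    have : n ≠ 0 := by omega
    exact_mod_cast this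
  have hterm : ∀ (J : KSubset n k) (j : Fin n),
      planarElement J (cycSet hkn j) - planarElement J (gapSet hk hkn j) =
        1 / n - if J.1 = cyc k j then 1 else 0 := by
    intro J j
    by_cases h : J.1 = cyc k j
    · have hJ : J = cycSet hkn j := Subtype.ext h
      have hd : (directedDist (cycSet hkn j) (gapSet hk hkn j) : ℝ) = n - 1 := by
        exact_mod_cast directedDist_cycSet_gapSet hk hkn j
      rw [if_pos h, hJ]
      simp only [planarElement, directedDist_self, hd]
      field_simp
      simp
    · have hJ : J ≠ cycSet hkn j := fun e => h (congrArg Subtype.val e)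
      rw [if_neg h]
      simp only [planarElement, directedDist_cycSet hk hkn hJ]
      push_cast
      ring
  have htot : ∀ J : KSubset n k, gapForm hk hkn (planarElement J) =
      1 - ∑ j : Fin n, if J.1 = cyc k j then (1 : ℝ) else 0 := by
    intro J
    rw [gapForm_apply, Finset.sum_congr rfl fun j _ => hterm J j, Finset.sum_sub_distrib]
    simp [hn]
  refine fun J => ⟨?_, fun h => ?_⟩
  · rintro ⟨j, hj⟩
    rw [htot, hj]
    simp [(cyc_injective hk hkn).eq_iff]
  · rw [htot, Finset.sum_eq_zero, sub_zero]
    exact fun j _ => if_neg fun hj => h ⟨j, hj⟩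

/-! ### The planar elements span -/

/-- The places `i` at which a step `e_i - e_{i+1}` out of `J` is possible. -/
def starts (J : Finset (Fin n)) : Finset (Fin n) :=
  Finset.univ.filter fun i => i ∉ J ∧ cycAdd i 1 ∈ J

lemma mem_starts {J : Finset (Fin n)} {i : Fin n} :
    i ∈ starts J ↔ i ∉ J ∧ cycAdd i 1 ∈ J := by
  simp [starts]

/-- The steps that are possible out of `J` can be made independently of each other. -/
lemma exists_isShift (hn : 2 ≤ n) (J : KSubset n k) (M : Finset (Fin n)) :
    M ⊆ starts J.1 → ∃ B : KSubset n k, IsShift J.1 B.1 M := by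
  induction M using Finset.induction_on with
  | empty => exact fun _ => ⟨J, fun i => by simp [ind]⟩
  | insert i M hiM ih =>
    intro hM
    rw [Finset.insert_subset_iff] at hM
    obtain ⟨B, hB⟩ := ih hM.2
    obtain ⟨hi, hi'⟩ := mem_starts.1 hM.1
    obtain ⟨y, rfl⟩ := (cycAdd_bijective 1).2 i
    have hyM : y ∉ M := fun h => hi (mem_starts.1 (hM.2 h)).2
    have h1 : cycAdd y 1 ∉ B.1 := by
      intro h
      have := hB y
      simp [ind, hi, hiM, hyM, h] at this
    have h2M : cycAdd (cycAdd y 1) 1 ∉ M := fun h => (mem_starts.1 (hM.2 h)).1 hi'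
    have h2 : cycAdd (cycAdd y 1) 1 ∈ B.1 := by
      by_contra h
      have := hB (cycAdd y 1)
      simp [ind, hi', hiM, h2M, h] at this
    obtain ⟨B', -, hB'⟩ := exists_isStep B h1 h2
    refine ⟨B', fun x => ?_⟩
    have e1 := hB x
    have e2 := isShift_step hn h1 h2 x
    rw [← hB'] at e2
    have e3 : ∀ z, ind (insert (cycAdd y 1) M) z = ind {cycAdd y 1} z + ind M z := by
      intro z
      by_cases hz : z = cycAdd y 1
      · subst hz; simp [ind, hiM]
      · simp [ind, hz]
    rw [e3, e3]
    linarith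

/-- Making the steps at `M ⊆ starts J` shortens the distance to `I` by one for each step; but
if one of these steps does not occur in the normal flow from `J` to `I`, then every step has to be
made once more. -/
lemma directedDist_of_isShift (hn : 2 ≤ n) {J B I : KSubset n k} {M : Finset (Fin n)}
    {m : Fin n → ℤ} (hm : IsNormalFlow J.1 I.1 m) (hM : IsShift J.1 B.1 M) :
    (directedDist B I : ℤ) =
      ∑ i, m i - M.card + n * (1 - if ∀ i ∈ M, 0 < m i then 1 else 0) := by
  have hf := hm.isFlow.sub_shift hM
  by_cases h : ∀ i ∈ M, 0 < m i
  · obtain ⟨z, hz⟩ := hm.exists_zero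
    have hzM : z ∉ M := fun hzM => (h z hzM).ne' hz
    rw [hf.directedDist_eq hn (μ := 0) (z := z), if_pos h, Finset.sum_sub_distrib, sum_ind]
    · ring
    · intro i
      by_cases hi : i ∈ M
      · rw [ind_of_mem hi]; linarith [h i hi]
      · rw [ind_of_notMem hi, sub_zero]; exact hm.nonneg i
    · rw [ind_of_notMem hzM, hz, sub_zero]
  · rw [if_neg h]
    push Not at h
    obtain ⟨z, hzM, hz⟩ := h
    have hz0 : m z = 0 := le_antisymm hz (hm.nonneg z)
    rw [hf.directedDist_eq hn (μ := -1) (z := z), Finset.sum_sub_distrib, sum_ind]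
    · ring
    · intro i
      linarith [hm.nonneg i, ind_le_one M i]
    · rw [ind_of_mem hzM, hz0, zero_sub]

lemma sum_powerset_neg_one_pow {α : Type*} [DecidableEq α] (s : Finset α) :
    ∑ M ∈ s.powerset, (-1 : ℝ) ^ M.card = if s = ∅ then 1 else 0 := by
  have := congrArg (Int.cast : ℤ → ℝ) (Finset.sum_powerset_neg_one_pow_card (x := s))
  push_cast at this
  exact this

lemma sum_powerset_neg_one_pow_mul_card {α : Type*} [DecidableEq α] (s : Finset α) :
    ∑ M ∈ s.powerset, (-1 : ℝ) ^ M.card * M.card = if s.card = 1 then -1 else 0 := by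
  induction s using Finset.induction_on with
  | empty => simp
  | insert a s ha ih =>
    have h : ∀ M ∈ s.powerset, (-1 : ℝ) ^ (insert a M).card * (insert a M).card =
        - ((-1 : ℝ) ^ M.card * M.card) - (-1) ^ M.card := by
      intro M hM
      rw [Finset.card_insert_of_notMem fun h => ha (Finset.mem_powerset.1 hM h)]
      push_cast
      ring
    rw [Finset.sum_powerset_insert ha, Finset.sum_congr rfl h, Finset.sum_sub_distrib,
      Finset.sum_neg_distrib, sum_powerset_neg_one_pow, Finset.card_insert_of_notMem ha]
    by_cases hs : s = ∅ <;> simp [hs]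

lemma sum_powerset_neg_one_pow_ite {α : Type*} [DecidableEq α] (s : Finset α) (p : α → Prop)
    [DecidablePred p] :
    ∑ M ∈ s.powerset, (-1 : ℝ) ^ M.card * (if ∀ i ∈ M, p i then 1 else 0) =
      if ∀ i ∈ s, ¬ p i then 1 else 0 := by
  have h1 : s.powerset.filter (fun M => ∀ i ∈ M, p i) = (s.filter p).powerset := by
    ext M
    simp only [Finset.mem_filter, Finset.mem_powerset, Finset.subset_iff]
    grind
  have h2 := sum_powerset_neg_one_pow (s.filter p)
  rw [← h1, Finset.sum_filter] at h2
  simp only [mul_ite, mul_one, mul_zero]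
  rw [h2]
  simp only [Finset.filter_eq_empty_iff]

lemma IsNormalFlow.forall_starts_iff {I J : KSubset n k} {m : Fin n → ℤ}
    (hm : IsNormalFlow J.1 I.1 m) : (∀ i ∈ starts J.1, ¬ 0 < m i) ↔ I = J := by
  constructor
  · intro h
    have h0 : ∀ i, m i = 0 := by
      by_contra! hne
      obtain ⟨y, hy⟩ := hne
      obtain ⟨i, hi, hi', hp⟩ := hm.exists_step (lt_of_le_of_ne (hm.nonneg y) hy.symm)
      exact h i (mem_starts.2 ⟨hi, hi'⟩) hp
    refine Subtype.ext (ext_of_ind_succ fun i => ?_)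
    have := hm.isFlow i
    rw [h0, h0] at this
    linarith
  · rintro rfl i -
    obtain ⟨z, hz⟩ := hm.exists_zero
    have := hm.isFlow.sub_eq_const (isFlow_zero _) i z
    simp only [hz, Pi.zero_apply, sub_zero] at this
    simp [this]

lemma starts_cyc {j i : Fin n} (h : cycAdd i 1 = j) (hk : 1 ≤ k) (hkn : k < n) :
    starts (cyc k j) = {i} := by
  ext x
  rw [mem_starts, Finset.mem_singleton]
  constructor
  · rintro ⟨hx, hx'⟩
    exact (cycAdd_bijective 1).1 ((cycAdd_one_eq_of_mem_cyc hx hx').trans h.symm)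
  · rintro rfl
    subst h
    refine ⟨?_, mem_cyc.2 ⟨0, by omega, cycAdd_zero _⟩⟩
    rw [mem_cyc]
    rintro ⟨t, ht, h⟩
    rw [cycAdd_cycAdd] at h
    have := cycAdd_inj (by omega) (by omega) (h.trans (cycAdd_zero x).symm)
    omega

/-- A weight `w` on the vertices that is orthogonal to all distances is determined by its total:
take the alternating sum of the distances over all choices of steps out of `J`. -/
lemma card_mul_eq_of_orthogonal (hn : 2 ≤ n) {w : KSubset n k → ℝ}
    (hw : ∀ J, ∑ I, (directedDist J I : ℝ) * w I = 0) {J : KSubset n k}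
    (hJ : (starts J.1).Nonempty) :
    n * w J = (∑ I, w I) * if (starts J.1).card = 1 then 1 else 0 := by
  have : Nonempty (Fin n) := ⟨⟨0, by omega⟩⟩
  choose m hm using fun I : KSubset n k => exists_isNormalFlow J.1 I.1 (J.2.trans I.2.symm)
  have hM : ∀ M ∈ (starts J.1).powerset,
      n * ∑ I, w I * (if ∀ i ∈ M, 0 < m I i then 1 else 0) = (∑ I, w I) * (n - M.card) := by
    intro M hMs
    obtain ⟨B, hB⟩ := exists_isShift hn J M (Finset.mem_powerset.1 hMs)
    have hd : ∀ I, (directedDist B I : ℝ) = directedDist J I - M.card +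
        n * (1 - if ∀ i ∈ M, 0 < m I i then 1 else 0) := by
      intro I
      have h1 := directedDist_of_isShift hn (hm I) hB
      rw [← (hm I).directedDist_eq hn] at h1
      have h2 := congrArg (Int.cast : ℤ → ℝ) h1
      push_cast at h2
      exact h2
    have h0 := hw B
    simp only [hd] at h0
    have h3 : ∑ I, (directedDist J I - M.card +
        n * (1 - if ∀ i ∈ M, 0 < m I i then (1 : ℝ) else 0)) * w I =
        ∑ I, (directedDist J I : ℝ) * w I + (∑ I, w I) * (n - M.card) -
          n * ∑ I, w I * (if ∀ i ∈ M, 0 < m I i then 1 else 0) := by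
      rw [Finset.sum_mul, Finset.mul_sum, ← Finset.sum_add_distrib, ← Finset.sum_sub_distrib]
      exact Finset.sum_congr rfl fun I _ => by ring
    rw [h3, hw] at h0
    linarith
  have hsum : ∑ M ∈ (starts J.1).powerset, (-1 : ℝ) ^ M.card *
      (n * ∑ I, w I * (if ∀ i ∈ M, 0 < m I i then 1 else 0)) = n * w J := by
    have h4 : ∀ M : Finset (Fin n), (-1 : ℝ) ^ M.card *
        (n * ∑ I, w I * (if ∀ i ∈ M, 0 < m I i then 1 else 0)) =
        ∑ I, n * w I * ((-1 : ℝ) ^ M.card * (if ∀ i ∈ M, 0 < m I i then 1 else 0)) := by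
      intro M
      rw [Finset.mul_sum, Finset.mul_sum]
      exact Finset.sum_congr rfl fun I _ => by ring
    simp only [h4]
    rw [Finset.sum_comm]
    have h6 : ∀ I, ∑ M ∈ (starts J.1).powerset, n * w I *
        ((-1 : ℝ) ^ M.card * (if ∀ i ∈ M, 0 < m I i then 1 else 0)) =
        n * w I * if I = J then 1 else 0 := by
      intro I
      have h7 := sum_powerset_neg_one_pow_ite (starts J.1) (fun i => 0 < m I i)
      simp only [(hm I).forall_starts_iff] at h7
      rw [← Finset.mul_sum, ← h7]
      congr!
    rw [Finset.sum_congr rfl fun I _ => h6 I]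
    simp
  rw [← hsum, Finset.sum_congr rfl fun M hMs => by rw [hM M hMs]]
  have h5 : ∀ M : Finset (Fin n), (-1 : ℝ) ^ M.card * ((∑ I, w I) * (n - M.card)) =
      (∑ I, w I) * (n * (-1 : ℝ) ^ M.card - (-1 : ℝ) ^ M.card * M.card) := fun M => by ring
  simp only [h5]
  rw [← Finset.mul_sum, Finset.sum_sub_distrib, ← Finset.mul_sum, sum_powerset_neg_one_pow,
    sum_powerset_neg_one_pow_mul_card, if_neg hJ.ne_empty]
  split_ifs <;> ring

/-- A linear functional that vanishes on all planar elements is zero. -/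
lemma eq_zero_of_planarElement (hk : 1 ≤ k) (hkn : k < n) (c : (KSubset n k → ℝ) →ₗ[ℝ] ℝ)
    (hc : ∀ J, c (planarElement J) = 0) : c = 0 := by
  have hn : 2 ≤ n := by omega
  have hn0 : (0 : ℝ) < n := by
    have : 0 < n := by omega
    exact_mod_cast this
  set w : KSubset n k → ℝ := fun I => c (Pi.single I 1) with hwdef
  have hcw : ∀ v, c v = ∑ I, v I * w I := fun v => by
    rw [LinearMap.pi_apply_eq_sum_univ c v]
    refine Finset.sum_congr rfl fun I _ => ?_
    rw [smul_eq_mul, hwdef]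
    congr 2
    funext K
    simp [Pi.single_apply, eq_comm]
  have hw : ∀ J, ∑ I, (directedDist J I : ℝ) * w I = 0 := by
    intro J
    have h := hc J
    rw [hcw] at h
    simp only [planarElement, mul_assoc] at h
    rw [← Finset.mul_sum] at h
    exact (mul_eq_zero.1 h).resolve_left (by positivity)
  let z : Fin n := ⟨0, by omega⟩
  have hne : cycSet hkn z ≠ cycSet hkn (cycAdd z 1) := fun h =>
    cycAdd_one_ne hn z (cyc_injective hk hkn (congrArg Subtype.val h)).symm
  have hst : ∀ J : KSubset n k, (starts J.1).Nonempty := by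
    intro J
    have : Nonempty (Fin n) := ⟨z⟩
    obtain ⟨I, hI⟩ : ∃ I, I ≠ J := by
      by_cases h : cycSet hkn z = J
      · exact ⟨_, fun h' => hne (h.trans h'.symm)⟩
      · exact ⟨_, h⟩
    obtain ⟨m, hm⟩ := exists_isNormalFlow J.1 I.1 (J.2.trans I.2.symm)
    by_contra hemp
    rw [Finset.not_nonempty_iff_eq_empty] at hemp
    exact hI (hm.forall_starts_iff.1 (by simp [hemp]))
  have hwJ := fun J => card_mul_eq_of_orthogonal hn hw (hst J)
  -- `w` is the same constant on all `J` with one start and zero elsewhere; as distances are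
  -- positive, orthogonality to the distances from one cyclic interval makes the constant vanish.
  have hσ : ∑ I, w I = 0 := by
    have h1 : (∑ I, w I) * ∑ I : KSubset n k,
        (directedDist (cycSet hkn z) I : ℝ) * (if (starts I.1).card = 1 then 1 else 0) = 0 := by
      have h2 : n * ∑ I, (directedDist (cycSet hkn z) I : ℝ) * w I = 0 := by rw [hw, mul_zero]
      refine Eq.trans ?_ h2
      rw [Finset.mul_sum, Finset.mul_sum]
      refine Finset.sum_congr rfl fun I _ => ?_
      linear_combination -(directedDist (cycSet hkn z) I : ℝ) * hwJ I
    refine (mul_eq_zero.1 h1).resolve_right (ne_of_gt ?_)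
    refine Finset.sum_pos' (fun I _ => by positivity)
      ⟨cycSet hkn (cycAdd z 1), Finset.mem_univ _, ?_⟩
    have : (starts (cycSet hkn (cycAdd z 1)).1).card = 1 := by
      change (starts (cyc k _)).card = 1
      rw [starts_cyc rfl hk hkn, Finset.card_singleton]
    rw [if_pos this, mul_one]
    exact_mod_cast directedDist_pos hn hne
  ext1 I
  ext
  have := hwJ I
  rw [hσ, zero_mul] at this
  simpa using (mul_eq_zero.1 this).resolve_left hn0.ne'

lemma IsPKWeight.eq (hk : 1 ≤ k) (hkn : k < n) {c c' : (KSubset n k → ℝ) →ₗ[ℝ] ℝ}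
    (h : IsPKWeight c) (h' : IsPKWeight c') : c = c' := by
  rw [← sub_eq_zero]
  refine eq_zero_of_planarElement hk hkn _ fun J => ?_
  rw [LinearMap.sub_apply]
  by_cases hJ : ∃ j : Fin n, J.1 = cyc k j
  · rw [(h J).1 hJ, (h' J).1 hJ, sub_zero]
  · rw [(h J).2 hJ, (h' J).2 hJ, sub_self]

lemma isPKWeight_pkWeight (hk : 1 ≤ k) (hkn : k < n) : IsPKWeight (pkWeight n k) :=
  Classical.epsilon_spec (p := IsPKWeight) ⟨_, isPKWeight_gapForm hk hkn⟩

/-- The PK weight is the sum of the differences over all cyclic intervals. -/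
lemma pkWeight_eq_gapForm (hk : 1 ≤ k) (hkn : k < n) : pkWeight n k = gapForm hk hkn :=
  (isPKWeight_pkWeight hk hkn).eq hk hkn (isPKWeight_gapForm hk hkn)

/-! ### Extremality of the cyclic intervals -/

/-- The three-term relations are invariant under rotation. -/
lemma IsPositiveTropicalPlucker.cyclic {π : KSubset n k → ℝ} (h : IsPositiveTropicalPlucker π)
    {S : Finset (Fin n)} (hS : S.card + 2 = k) {a b c d : Fin n}
    (hcyc : (a < b ∧ b < c ∧ c < d) ∨ (d < a ∧ a < b ∧ b < c) ∨ (c < d ∧ d < a ∧ a < b) ∨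
      (b < c ∧ c < d ∧ d < a)) (ha : a ∉ S) (hb : b ∉ S) (hc : c ∉ S) (hd : d ∉ S) :
    coord π (S ∪ {a, c}) + coord π (S ∪ {b, d}) ≤
      coord π (S ∪ {a, b}) + coord π (S ∪ {c, d}) := by
  rcases hcyc with ⟨h1, h2, h3⟩ | ⟨h1, h2, h3⟩ | ⟨h1, h2, h3⟩ | ⟨h1, h2, h3⟩
  · rw [h S hS a b c d h1 h2 h3 ha hb hc hd]
    exact min_le_left _ _
  · have := h S hS d a b c h1 h2 h3 hd ha hb hc
    rw [add_comm, Finset.pair_comm b d, this, add_comm (coord π (S ∪ {a, b})),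
      Finset.pair_comm c d]
    exact min_le_right _ _
  · have := h S hS c d a b h1 h2 h3 hc hd ha hb
    rw [Finset.pair_comm a c, Finset.pair_comm b d, this, add_comm (coord π (S ∪ {a, b}))]
    exact min_le_left _ _
  · have := h S hS b c d a h1 h2 h3 hb hc hd ha
    rw [add_comm, Finset.pair_comm a c, this, Finset.pair_comm a b]
    exact min_le_right _ _

lemma cyclic_order (j : Fin n) {p q r s : ℕ} (h1 : p < q) (h2 : q < r) (h3 : r < s) (h4 : s < n) :
    (cycAdd j p < cycAdd j q ∧ cycAdd j q < cycAdd j r ∧ cycAdd j r < cycAdd j s) ∨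
    (cycAdd j s < cycAdd j p ∧ cycAdd j p < cycAdd j q ∧ cycAdd j q < cycAdd j r) ∨
    (cycAdd j r < cycAdd j s ∧ cycAdd j s < cycAdd j p ∧ cycAdd j p < cycAdd j q) ∨
    (cycAdd j q < cycAdd j r ∧ cycAdd j r < cycAdd j s ∧ cycAdd j s < cycAdd j p) := by
  have hv : ∀ t < n, (j.val + t < n ∧ (cycAdd j t).val = j.val + t) ∨
      (n ≤ j.val + t ∧ (cycAdd j t).val + n = j.val + t) := by
    intro t ht
    have hj := j.isLt
    by_cases hlt : j.val + t < n
    · exact Or.inl ⟨hlt, Nat.mod_eq_of_lt hlt⟩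
    · refine Or.inr ⟨by omega, ?_⟩
      change (j.val + t) % n + n = _
      rw [Nat.mod_eq_sub_mod (by omega), Nat.mod_eq_of_lt (by omega)]
      omega
  simp only [Fin.lt_def]
  have := hv p (by omega)
  have := hv q (by omega)
  have := hv r (by omega)
  have := hv s (by omega)
  omega

lemma insert_insert_eq_union {α : Type*} [DecidableEq α] (x y : α) (S : Finset α) :
    insert x (insert y S) = S ∪ {x, y} := by
  grind

/-- Among all pairs `T ∪ {a}`, `T ∪ {b}` with `b = a + 1`, the difference
`π (T ∪ {a}) - π (T ∪ {b})` is largest when `T ∪ {a}` is the cyclic interval that ends with `a`: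
by a three-term relation the difference does not decrease when an element of `T` is replaced by one
that comes later in the cyclic order starting at `b`. -/
lemma IsPositiveTropicalPlucker.sub_le_gap {π : KSubset n k → ℝ}
    (h : IsPositiveTropicalPlucker π) (hk : 1 ≤ k) (hkn : k < n) (j : Fin n) (N : ℕ) :
    ∀ T : Finset (Fin n), (stem k j \ T).card = N → T.card + 1 = k → cycAdd j (k - 1) ∉ T →
      cycAdd j k ∉ T →
      coord π (insert (cycAdd j (k - 1)) T) - coord π (insert (cycAdd j k) T) ≤
        coord π (cyc k j) - coord π (gap k j) := by
  induction N with
  | zero =>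
    intro T hN hT _ _
    rw [Finset.card_eq_zero, Finset.sdiff_eq_empty_iff_subset] at hN
    have := Finset.eq_of_subset_of_card_le hN (by rw [card_stem hkn]; omega)
    rw [← this, cyc_eq_insert hk, gap_eq_insert]
  | succ N ih =>
    intro T hN hT ha hb
    obtain ⟨s, hs⟩ : (stem k j \ T).Nonempty := Finset.card_pos.1 (by omega)
    obtain ⟨c, hc⟩ : (T \ stem k j).Nonempty := by
      rw [← Finset.card_pos, ← Finset.card_sdiff_comm (s := stem k j), hN]
      · omega
      · rw [card_stem hkn]; omega
    rw [Finset.mem_sdiff] at hs hc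
    obtain ⟨p, hp, hps⟩ := mem_stem.1 hs.1
    obtain ⟨q, hq, hqc⟩ := exists_cycAdd_eq j c
    have hq1 : k < q := by
      by_contra hle
      rcases (show q < k - 1 ∨ q = k - 1 ∨ q = k by omega) with hlt | rfl | rfl
      · exact hc.2 (mem_stem.2 ⟨q, hlt, hqc⟩)
      · exact ha (hqc ▸ hc.1)
      · exact hb (hqc ▸ hc.1)
    have hord := cyclic_order j (p := p) (q := k - 1) (r := k) (s := q) hp (by omega) hq1 hq
    rw [hps, hqc] at hord
    have hsa : s ≠ cycAdd j (k - 1) := fun e => last_notMem_stem hk hkn j (e ▸ hs.1)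
    have hsb : s ≠ cycAdd j k := fun e => next_notMem_stem hkn j (e ▸ hs.1)
    have hcard : (T.erase c).card + 2 = k := by
      rw [Finset.card_erase_of_mem hc.1]
      have := Finset.card_pos.2 ⟨c, hc.1⟩
      omega
    have hrel := h.cyclic hcard hord (by simp [hs.2]) (by simp [ha]) (by simp [hb]) (by simp)
    have hih := ih (insert s (T.erase c)) ?_ ?_ ?_ ?_
    · rw [insert_insert_eq_union, insert_insert_eq_union, Finset.pair_comm _ s,
        Finset.pair_comm _ s] at hih
      rw [← Finset.insert_erase hc.1, insert_insert_eq_union, insert_insert_eq_union]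
      linarith
    · have : stem k j \ insert s (T.erase c) = (stem k j \ T).erase s := by
        ext x
        simp only [Finset.mem_sdiff, Finset.mem_insert, Finset.mem_erase]
        have : x ∈ stem k j → x ≠ c := fun hx e => hc.2 (e ▸ hx)
        tauto
      rw [this, Finset.card_erase_of_mem (Finset.mem_sdiff.2 hs), hN]
      rfl
    · rw [Finset.card_insert_of_notMem (by simp [hs.2])]
      omega
    · simp [ha, hsa.symm]
    · simp [hb, hsb.symm]

lemma coord_coe (π : KSubset n k → ℝ) (I : KSubset n k) : coord π I.1 = π I := dif_pos I.2

lemma gapForm_eq_sum_coord (hk : 1 ≤ k) (hkn : k < n) (π : KSubset n k → ℝ) :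
    gapForm hk hkn π = ∑ j : Fin n, (coord π (cyc k j) - coord π (gap k j)) := by
  rw [gapForm_apply]
  exact Finset.sum_congr rfl fun j _ =>
    (congrArg₂ _ (coord_coe π (cycSet hkn j)) (coord_coe π (gapSet hk hkn j))).symm

/-! ### Nonnegativity of the PK weight -/

lemma IsPositiveTropicalPlucker.step_le {π : KSubset n k → ℝ}
    (h : IsPositiveTropicalPlucker π) (hk : 1 ≤ k) (hkn : k < n) {A B : KSubset n k} {j : Fin n}
    (hi : cycAdd j (k - 1) ∉ A.1) (hi' : cycAdd j k ∈ A.1)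
    (hB : B.1 = insert (cycAdd j (k - 1)) (A.1.erase (cycAdd j k))) :
    π B - π A ≤ coord π (cyc k j) - coord π (gap k j) := by
  have hcard : (A.1.erase (cycAdd j k)).card + 1 = k := by
    rw [Finset.card_erase_of_mem hi', A.2]
    omega
  have := h.sub_le_gap hk hkn j _ (A.1.erase (cycAdd j k)) rfl hcard (by simp [hi]) (by simp)
  rwa [← hB, Finset.insert_erase hi', coord_coe, coord_coe] at this

lemma ind_singleton_cycAdd (j l : Fin n) (t : ℕ) :
    ind {cycAdd j t} (cycAdd l t) = if l = j then 1 else 0 := by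
  have : cycAdd l t = cycAdd j t ↔ l = j := (cycAdd_bijective t).1.eq_iff
  simp [ind, this]

/-- Along a normal flow, each step `e_i - e_{i+1}` increases a positive tropical Plücker vector by
at most the difference at the cyclic interval that ends with `i`. -/
lemma IsPositiveTropicalPlucker.sub_le_sum_flow {π : KSubset n k → ℝ}
    (h : IsPositiveTropicalPlucker π) (hk : 1 ≤ k) (hkn : k < n) {B : KSubset n k} (L : ℕ) :
    ∀ {A : KSubset n k} {m : Fin n → ℤ}, IsNormalFlow A.1 B.1 m → ∑ i, m i = L →
      π B - π A ≤
        ∑ j, m (cycAdd j (k - 1)) * (coord π (cyc k j) - coord π (gap k j)) := by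
  induction L with
  | zero =>
    intro A m hm hs
    obtain ⟨rfl, h0⟩ := hm.eq_of_sum_eq_zero hs
    simp [h0]
  | succ L ih =>
    intro A m hm hs
    obtain ⟨i, C, hi, hi', hC, hm', hs'⟩ := hm.exists_step_sub (by omega) hs
    obtain ⟨j, rfl⟩ := (cycAdd_bijective (k - 1)).2 i
    simp only [succ_last hk] at hi hi' hC
    have h1 := h.step_le hk hkn hi hi' hC
    have h2 := ih hm' hs'
    simp only [ind_singleton_cycAdd, Int.cast_sub, sub_mul, Finset.sum_sub_distrib] at h2
    simp at h2
    linarith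

/-- Going once around the circle, from `cyc k j` to `gap k j` and back, uses each step once. -/
lemma IsPositiveTropicalPlucker.gapForm_nonneg {π : KSubset n k → ℝ}
    (h : IsPositiveTropicalPlucker π) (hk : 1 ≤ k) (hkn : k < n) : 0 ≤ gapForm hk hkn π := by
  let j : Fin n := ⟨0, by omega⟩
  have hm : IsNormalFlow (cycSet hkn j).1 (gapSet hk hkn j).1
      (fun x => 1 - ind {cycAdd j (k - 1)} x) :=
    ⟨fun x => by have := isFlow_cyc_gap hk hkn j x; simp only [cycSet, gapSet]; linarith,
      fun x => by linarith [ind_le_one {cycAdd j (k - 1)} x], cycAdd j (k - 1),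
      by rw [ind_of_mem (by simp), sub_self]⟩
  obtain ⟨L, hL⟩ := Int.eq_ofNat_of_zero_le (Finset.sum_nonneg fun i _ => hm.nonneg i)
  have h1 := h.sub_le_sum_flow hk hkn L hm hL
  simp only [ind_singleton_cycAdd, Int.cast_sub, sub_mul, Finset.sum_sub_distrib] at h1
  rw [gapForm_eq_sum_coord, Finset.sum_sub_distrib]
  rw [← coord_coe π (cycSet hkn j), ← coord_coe π (gapSet hk hkn j)] at h1
  simp [cycSet, gapSet] at h1
  linarith

/-! ### Representatives modulo lineality -/

lemma mem_lineality {l : KSubset n k → ℝ} :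
    l ∈ lineality n k ↔ ∃ y : Fin n → ℝ, ∀ I, l I = ∑ i ∈ I.1, y i := by
  rw [lineality, Submodule.mem_span_range_iff_exists_fun]
  refine exists_congr fun y => ?_
  rw [funext_iff]
  refine forall_congr' fun I => ?_
  rw [Finset.sum_apply]
  simp [eq_comm]

lemma coord_eq_add_sum {π ρ : KSubset n k → ℝ} {y : Fin n → ℝ}
    (h : ∀ I, (ρ - π) I = ∑ i ∈ I.1, y i) {I : Finset (Fin n)} (hI : I.card = k) :
    coord ρ I = coord π I + ∑ i ∈ I, y i := by
  have := h ⟨I, hI⟩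
  rw [Pi.sub_apply, ← coord_coe ρ, ← coord_coe π] at this
  linarith

lemma gap_difference_eq (hk : 1 ≤ k) (hkn : k < n) {π ρ : KSubset n k → ℝ} {y : Fin n → ℝ}
    (h : ∀ I, (ρ - π) I = ∑ i ∈ I.1, y i) (j : Fin n) :
    coord ρ (cyc k j) - coord ρ (gap k j) = coord π (cyc k j) - coord π (gap k j) +
      (y (cycAdd j (k - 1)) - y (cycAdd j k)) := by
  rw [coord_eq_add_sum h (card_cyc hkn j), coord_eq_add_sum h (card_gap hk hkn j),
    cyc_eq_insert hk, gap_eq_insert, Finset.sum_insert (last_notMem_stem hk hkn j),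
    Finset.sum_insert (next_notMem_stem hkn j)]
  ring

lemma gapForm_eq_of_sub_mem_lineality (hk : 1 ≤ k) (hkn : k < n) {π ρ : KSubset n k → ℝ}
    (h : ρ - π ∈ lineality n k) : gapForm hk hkn ρ = gapForm hk hkn π := by
  obtain ⟨y, hy⟩ := mem_lineality.1 h
  have h0 : ∑ j, (y (cycAdd j (k - 1)) - y (cycAdd j k)) = 0 := by
    rw [Finset.sum_sub_distrib, sum_cycAdd, sum_cycAdd, sub_self]
  rw [gapForm_eq_sum_coord, gapForm_eq_sum_coord,
    Finset.sum_congr rfl fun j _ => gap_difference_eq hk hkn hy j, Finset.sum_add_distrib, h0,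
    add_zero]

lemma IsPositiveTropicalPlucker.of_sub_mem_lineality {π ρ : KSubset n k → ℝ}
    (hπ : IsPositiveTropicalPlucker π) (h : ρ - π ∈ lineality n k) :
    IsPositiveTropicalPlucker ρ := by
  obtain ⟨y, hy⟩ := mem_lineality.1 h
  intro S hS a b c d hab hbc hcd ha hb hc hd
  have e : ∀ u v, u < v → u ∉ S → v ∉ S →
      coord ρ (S ∪ {u, v}) = coord π (S ∪ {u, v}) + (∑ i ∈ S, y i + y u + y v) := by
    intro u v huv hu hv
    have hdis : Disjoint S {u, v} := by simp [hu, hv]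
    rw [coord_eq_add_sum hy, Finset.sum_union hdis, Finset.sum_pair huv.ne,
      add_assoc (∑ i ∈ S, y i)]
    rw [Finset.card_union_of_disjoint hdis, Finset.card_pair huv.ne, hS]
  have hrel := hπ S hS a b c d hab hbc hcd ha hb hc hd
  rw [e a c (hab.trans hbc) ha hc, e b d (hbc.trans hcd) hb hd, e a b hab ha hb, e c d hcd hc hd,
    e a d (hab.trans (hbc.trans hcd)) ha hd, e b c hbc hb hc]
  set t := 2 * ∑ i ∈ S, y i + y a + y b + y c + y d
  calc _ = (coord π (S ∪ {a, c}) + coord π (S ∪ {b, d})) + t := by ring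
    _ = min (coord π (S ∪ {a, b}) + coord π (S ∪ {c, d}) + t)
          (coord π (S ∪ {a, d}) + coord π (S ∪ {b, c}) + t) := by rw [hrel, min_add_add_right]
    _ = _ := by congr 1 <;> ring

lemma exists_potential (r : Fin n → ℝ) (hr : ∑ i, r i = 0) :
    ∃ y : Fin n → ℝ, ∀ i, y i - y (cycAdd i 1) = r i := by
  refine ⟨fun i => - ∑ l ∈ Finset.Iio i, r l, fun i => ?_⟩
  have hi := i.isLt
  have h1 : ∑ l ∈ Finset.Iic i, r l = r i + ∑ l ∈ Finset.Iio i, r l := by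
    rw [← Finset.Iio_insert, Finset.sum_insert (by simp)]
  by_cases hl : i.val + 1 < n
  · have hv : (cycAdd i 1).val = i.val + 1 := Nat.mod_eq_of_lt hl
    have : Finset.Iio (cycAdd i 1) = Finset.Iic i := by
      ext x
      simp only [Finset.mem_Iio, Finset.mem_Iic, Fin.lt_def, Fin.le_def, hv]
      omega
    simp only [this, h1]
    ring
  · have hv : (cycAdd i 1).val = 0 := by
      simp [cycAdd, show i.val + 1 = n by omega]
    have h2 : Finset.Iio (cycAdd i 1) = ∅ := by
      ext x
      simp [Fin.lt_def, hv]
    have h3 : Finset.Iic i = Finset.univ := by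
      ext x
      simp only [Finset.mem_Iic, Finset.mem_univ, Fin.le_def, iff_true]
      omega
    rw [h3, hr] at h1
    simp only [h2, Finset.sum_empty]
    linarith

lemma exists_isBalancedRep (hk : 1 ≤ k) (hkn : k < n) (π : KSubset n k → ℝ) :
    ∃ ρ, IsBalancedRep π ρ := by
  have hn : (n : ℝ) ≠ 0 := by
    have : n ≠ 0 := by omega
    exact_mod_cast this
  obtain ⟨z, hz⟩ := exists_potential (fun j : Fin n => 1 / (n : ℝ) * gapForm hk hkn π -
    (coord π (cyc k j) - coord π (gap k j))) (by
      rw [Finset.sum_sub_distrib, ← gapForm_eq_sum_coord hk hkn]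
      simp [hn])
  let e := Equiv.ofBijective _ (cycAdd_bijective (n := n) (k - 1))
  have he : ∀ j, e.symm (cycAdd j (k - 1)) = j := e.symm_apply_apply
  refine ⟨fun I => π I + ∑ i ∈ I.1, z (e.symm i), ?_, fun j => ?_⟩
  · exact mem_lineality.2 ⟨fun i => z (e.symm i), fun I => by simp⟩
  · rw [gap_difference_eq hk hkn (π := π) (y := fun i => z (e.symm i)) (fun I => by simp) j,
      show cycAdd j k = cycAdd (cycAdd j 1) (k - 1) by
        rw [cycAdd_cycAdd, Nat.add_sub_cancel' hk], he, he, hz, pkWeight_eq_gapForm hk hkn]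
    ring

/-! ### The bounded complex -/

lemma coordDiff_toTorus (u v : Fin n) (x : Fin n → ℝ) : coordDiff u v (toTorus x) = x u - x v :=
  rfl

lemma toTorus_surjective : Function.Surjective (toTorus (n := n)) :=
  Submodule.mkQ_surjective _

lemma coordDiff_le_tropDist (u v : Fin n) (x y : Torus n) : coordDiff u v (x - y) ≤ tropDist x y :=
  le_ciSup (f := fun p : Fin n × Fin n => coordDiff p.1 p.2 (x - y)) (Set.finite_range _).bddAbove
    (u, v)

/-- The matroid of a bounded cell has no coloop: the cell would contain the ray in the direction
of the coloop. -/
lemma exists_notMem_of_isBddSet (hn : 2 ≤ n) {π : KSubset n k → ℝ} {w : Fin n → ℝ}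
    (h : IsBddSet (dualCell π (initialBases (shift π w)))) (a : Fin n) :
    ∃ I ∈ initialBases (shift π w), a ∉ I.1 := by
  by_contra! hall
  obtain ⟨C, hC⟩ := h
  set t := |C| + 1
  have ht : 0 ≤ t := by positivity
  have hray : toTorus (w + Pi.single a t) ∈ dualCell π (initialBases (shift π w)) := by
    refine ⟨_, fun I hI J => ?_, rfl⟩
    have hsum : ∀ K : KSubset n k, shift π (w + Pi.single a t) K =
        shift π w K - if a ∈ K.1 then t else 0 := by
      intro K
      simp only [shift, Pi.add_apply, Finset.sum_add_distrib, Finset.sum_pi_single']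
      ring
    have h1 := hI J
    rw [hsum, hsum, if_pos (hall I hI)]
    split_ifs <;> linarith
  have hw : toTorus w ∈ dualCell π (initialBases (shift π w)) := ⟨w, fun _ hI => hI, rfl⟩
  have h1 := coordDiff_le_tropDist a (cycAdd a 1) (toTorus (w + Pi.single a t)) (toTorus w)
  rw [← map_sub, coordDiff_toTorus] at h1
  have h2 := h1.trans (hC _ hray _ hw)
  simp [cycAdd_one_ne hn a] at h2
  linarith [le_abs_self C]

/-- The matroid of a point of the tropical linear space has no loop: an element can be exchanged
into each basis. -/
lemma exists_mem_initialBases_insert {π : KSubset n k → ℝ} {w : Fin n → ℝ}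
    (hw : toTorus w ∈ tropLinearSpace π) {J : KSubset n k} (hJ : J ∈ initialBases (shift π w))
    {b : Fin n} (hb : b ∉ J.1) :
    ∃ I ∈ initialBases (shift π w), b ∈ I.1 ∧ I.1 ⊆ insert b J.1 := by
  -- The representative supplied by membership in `tropLinearSpace` differs from `w` by a constant.
  obtain ⟨w', hw', he⟩ := hw
  have hc : ∃ c : ℝ, ∀ i, w' i = w i + c := by
    have := (Submodule.Quotient.eq _).1 he
    obtain ⟨c, hc⟩ := Submodule.mem_span_singleton.1 this
    refine ⟨c, fun i => ?_⟩
    have := congrFun hc i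
    simp at this
    linarith
  obtain ⟨c, hc⟩ := hc
  set τ := insert b J.1 with hτ
  have hτc : τ.card = k + 1 := by rw [hτ, Finset.card_insert_of_notMem hb, J.2]
  have hex : ∃ l ∈ τ, l ≠ b ∧ coord π (τ.erase l) + w' l ≤ coord π (τ.erase b) + w' b := by
    obtain ⟨i, hi, j, hj, hij, heq, hmin⟩ := hw' τ hτc
    have hmb := hmin b (Finset.mem_insert_self _ _)
    by_cases hib : i = b
    · exact ⟨j, hj, fun h => hij (hib.trans h.symm), heq ▸ hmb⟩
    · exact ⟨i, hi, hib, hmb⟩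
  obtain ⟨l, hl, hlb, hle⟩ := hex
  have hIc : (τ.erase l).card = k := by rw [Finset.card_erase_of_mem hl, hτc]; rfl
  refine ⟨⟨τ.erase l, hIc⟩, fun K => le_trans ?_ (hJ K),
    Finset.mem_erase.2 ⟨hlb.symm, Finset.mem_insert_self _ _⟩, Finset.erase_subset _ _⟩
  have e1 := Finset.sum_erase_add τ w hl
  have e2 : ∑ i ∈ τ, w i = w b + ∑ i ∈ J.1, w i := Finset.sum_insert hb
  rw [hτ, Finset.erase_insert hb, ← hτ, coord_coe, hc, hc] at hle
  simp only [shift]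
  rw [← coord_coe π ⟨τ.erase l, hIc⟩]
  simp only
  linarith

/-- The defining inequalities of an alcoved simplex hold on the bounded complex. If the inequality
between `a` and `b = a + 1` fails, then by extremality of the cyclic interval each basis that
contains `b` also contains `a`; but exchanging `b` into a basis without `a` gives a basis with `b`
and without `a`. -/
lemma IsPositiveTropicalPlucker.coordDiff_le {π : KSubset n k → ℝ}
    (h : IsPositiveTropicalPlucker π) (hk : 1 ≤ k) (hkn : k < n) {x : Torus n}
    (hx : x ∈ boundedComplex π) (j : Fin n) :
    coordDiff (cycAdd j (k - 1)) (cycAdd j k) x ≤ coord π (cyc k j) - coord π (gap k j) := by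
  obtain ⟨F, ⟨w, hw, rfl⟩, hbdd, y, hy, rfl⟩ := hx
  rw [coordDiff_toTorus]
  by_contra! hlt
  -- Otherwise replacing `b` by `a` would give a smaller value of `π^y`.
  have hnext : ∀ I ∈ initialBases (shift π w), cycAdd j k ∈ I.1 → cycAdd j (k - 1) ∈ I.1 := by
    intro I hI hbI
    by_contra haI
    have haT : cycAdd j (k - 1) ∉ I.1.erase (cycAdd j k) := by simp [haI]
    have hcard : (insert (cycAdd j (k - 1)) (I.1.erase (cycAdd j k))).card = k := by
      rw [Finset.card_insert_of_notMem haT, Finset.card_erase_of_mem hbI, I.2]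
      omega
    have h1 := h.step_le hk hkn (B := ⟨_, hcard⟩) haI hbI rfl
    have h2 := hy hI ⟨_, hcard⟩
    simp only [shift] at h2
    rw [Finset.sum_insert haT] at h2
    have h3 := Finset.sum_erase_add I.1 y hbI
    linarith
  obtain ⟨J, hJ, haJ⟩ := exists_notMem_of_isBddSet (by omega) hbdd (cycAdd j (k - 1))
  have hbJ : cycAdd j k ∉ J.1 := fun hb => haJ (hnext J hJ hb)
  obtain ⟨I, hI, hbI, hsub⟩ := exists_mem_initialBases_insert hw hJ hbJ
  rcases Finset.mem_insert.1 (hsub (hnext I hI hbI)) with h1 | h1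
  · exact last_ne_next hk hkn j h1
  · exact haJ h1

lemma exists_arc_torus (hk : 1 ≤ k) (u v : Fin n) : ∃ A : Finset (Fin n), ∀ x : Torus n,
    coordDiff u v x = ∑ j ∈ A, coordDiff (cycAdd j (k - 1)) (cycAdd j k) x := by
  obtain ⟨u, rfl⟩ := (cycAdd_bijective (k - 1)).2 u
  obtain ⟨v, rfl⟩ := (cycAdd_bijective (k - 1)).2 v
  obtain ⟨A, hA⟩ := exists_arc u v
  refine ⟨A, fun x => ?_⟩
  obtain ⟨z, rfl⟩ := toTorus_surjective x
  simp only [coordDiff_toTorus]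
  rw [hA fun i => z (cycAdd i (k - 1))]
  simp only [cycAdd_cycAdd, Nat.add_sub_cancel' hk]

lemma sum_coordDiff_eq_zero (x : Torus n) :
    ∑ j, coordDiff (cycAdd j (k - 1)) (cycAdd j k) x = 0 := by
  obtain ⟨z, rfl⟩ := toTorus_surjective x
  simp only [coordDiff_toTorus]
  rw [Finset.sum_sub_distrib, sum_cycAdd, sum_cycAdd, sub_self]

/-- On the arc from `u` to `v` the coordinate differences of `x` are bounded, on the complementary
arc those of `y`, and the two bounds add up to the PK weight. -/
lemma IsPositiveTropicalPlucker.tropDist_le {π : KSubset n k → ℝ}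
    (h : IsPositiveTropicalPlucker π) (hk : 1 ≤ k) (hkn : k < n) {x y : Torus n}
    (hx : x ∈ boundedComplex π) (hy : y ∈ boundedComplex π) :
    tropDist x y ≤ gapForm hk hkn π := by
  have : Nonempty (Fin n × Fin n) := ⟨(⟨0, by omega⟩, ⟨0, by omega⟩)⟩
  refine ciSup_le fun ⟨u, v⟩ => ?_
  obtain ⟨A, hA⟩ := exists_arc_torus hk u v
  have h1 := Finset.sum_le_sum fun j (_ : j ∈ A) => h.coordDiff_le hk hkn hx j
  have h2 := Finset.sum_le_sum fun j (_ : j ∈ Aᶜ) => h.coordDiff_le hk hkn hy j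
  have h3 := Finset.sum_add_sum_compl A fun j => coordDiff (cycAdd j (k - 1)) (cycAdd j k) y
  have h4 := Finset.sum_add_sum_compl A fun j => coord π (cyc k j) - coord π (gap k j)
  rw [sum_coordDiff_eq_zero, ← hA] at h3
  rw [← gapForm_eq_sum_coord hk hkn] at h4
  rw [← hA] at h1
  rw [map_sub]
  linarith

lemma mem_smul_alcovedSimplex {r : ℝ} (hr : 0 ≤ r) {x : Torus n}
    (h : ∀ u v, coordDiff u v x ≤ r) : x ∈ r • alcovedSimplex n := by
  rcases hr.eq_or_lt with rfl | hr
  · refine ⟨0, fun u v => by simp, ?_⟩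
    obtain ⟨z, rfl⟩ := toTorus_surjective x
    simp only [zero_smul]
    symm
    refine (Submodule.Quotient.mk_eq_zero _).2 ?_
    rcases isEmpty_or_nonempty (Fin n) with he | ⟨⟨u⟩⟩
    · rw [Subsingleton.elim z 0]
      exact zero_mem _
    · refine Submodule.mem_span_singleton.2 ⟨z u, ?_⟩
      funext v
      have h1 := h u v
      have h2 := h v u
      rw [coordDiff_toTorus] at h1 h2
      simp only [Pi.smul_apply, Pi.one_apply, smul_eq_mul, mul_one]
      linarith
  · refine ⟨r⁻¹ • x, fun u v => ?_, smul_inv_smul₀ hr.ne' x⟩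
    rw [map_smul, smul_eq_mul, inv_mul_le_one₀ hr]
    exact h u v

lemma IsPositiveTropicalPlucker.boundedComplex_subset {π : KSubset n k → ℝ}
    (h : IsPositiveTropicalPlucker π) (hk : 1 ≤ k) (hkn : k < n) {r : ℝ} (hr : 0 ≤ r)
    (hbal : ∀ j : Fin n, coord π (cyc k j) - coord π (gap k j) = 1 / (n : ℝ) * r) :
    boundedComplex π ⊆ r • alcovedSimplex n := by
  intro x hx
  have hn : (0 : ℝ) < n := by
    have : 0 < n := by omega
    exact_mod_cast this
  refine mem_smul_alcovedSimplex hr fun u v => ?_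
  obtain ⟨A, hA⟩ := exists_arc_torus hk u v
  have hcard : (A.card : ℝ) ≤ n := by
    have := Finset.card_le_univ A
    rw [Fintype.card_fin] at this
    exact_mod_cast this
  have hsum : coordDiff u v x ≤ A.card * (1 / (n : ℝ) * r) := by
    rw [hA, ← nsmul_eq_mul]
    exact Finset.sum_le_card_nsmul _ _ _ fun j _ => (h.coordDiff_le hk hkn hx j).trans_eq (hbal j)
  calc _ ≤ _ := hsum
    _ ≤ n * (1 / (n : ℝ) * r) := by gcongr
    _ = r := by field_simp

end PosTrop

theorem theorem9p1 (k n : ℕ) (hk : 2 ≤ k) (hkn : k < n) :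
    -- the PK weight is well defined: it is the only linear functional with the prescribed values
    (PosTrop.IsPKWeight (PosTrop.pkWeight n k) ∧
      ∀ wt : (PosTrop.KSubset n k → ℝ) →ₗ[ℝ] ℝ,
        PosTrop.IsPKWeight wt → wt = PosTrop.pkWeight n k) ∧
    ∀ π : PosTrop.KSubset n k → ℝ, PosTrop.IsPositiveTropicalPlucker π →
      0 ≤ PosTrop.pkWeight n k π ∧
      -- a balanced central representative exists
      (∃ ρ : PosTrop.KSubset n k → ℝ, PosTrop.IsBalancedRep π ρ) ∧
      -- its bounded complex lies in the dilated simplex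
      (∀ ρ : PosTrop.KSubset n k → ℝ, PosTrop.IsBalancedRep π ρ →
        PosTrop.boundedComplex ρ ⊆
          PosTrop.pkWeight n k π • PosTrop.alcovedSimplex n) ∧
      -- the bounded complex of every representative has diameter at most the PK weight
      (∀ ρ : PosTrop.KSubset n k → ℝ, ρ - π ∈ PosTrop.lineality n k →
        ∀ x ∈ PosTrop.boundedComplex ρ, ∀ y ∈ PosTrop.boundedComplex ρ,
          PosTrop.tropDist x y ≤ PosTrop.pkWeight n k π) := by
  have hk1 : 1 ≤ k := by omega
  have hpk := PosTrop.isPKWeight_pkWeight hk1 hkn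
  refine ⟨⟨hpk, fun wt h => h.eq hk1 hkn hpk⟩, fun π hπ => ?_⟩
  have hwt : PosTrop.pkWeight n k π = PosTrop.gapForm hk1 hkn π := by
    rw [PosTrop.pkWeight_eq_gapForm hk1 hkn]
  have hnonneg : 0 ≤ PosTrop.pkWeight n k π := hwt ▸ hπ.gapForm_nonneg hk1 hkn
  refine ⟨hnonneg, PosTrop.exists_isBalancedRep hk1 hkn π, fun ρ hρ => ?_,
    fun ρ hρ x hx y hy => ?_⟩
  · exact (hπ.of_sub_mem_lineality hρ.1).boundedComplex_subset hk1 hkn hnonneg hρ.2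
  · rw [hwt, ← PosTrop.gapForm_eq_of_sub_mem_lineality hk1 hkn hρ]
    exact (hπ.of_sub_mem_lineality hρ).tropDist_le hk1 hkn hx hy
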